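/- **Model.** A network is a connected simple graph $G$ on $n$ nodes with indices $1,\dots,n$; each node has a unique positive integer identifier, and all nodes know a common upper bound $N$ on $n$ and on the identifiers. A (deterministic) algorithm runs in synchronous rounds: in each round every non-terminated node may send a message (a bit string) to each of its neighbors, receives the messages sent by its neighbors, and updates its state by an arbitrary local rule, the same at all nodes; a node terminates when it outputs *accept* or *reject*. It is a CONGEST algorithm if in $n$-node networks all messages have $O(\log n)$ bits. On a given network, the node-activation of an algorithm is the maximum, over all nodes $v$, of the number of rounds in which $v$ sends a message to at least one neighbor, and the edge-activation is the maximum, over all edges $e$, of the number of rounds in which a message traverses $e$ in at least one direction. An algorithm *solves* a decision problem in polynomially many rounds if there is a polynomially bounded $R$ such that on every input with $\nu$ nodes all nodes have terminated after $R(\nu)$ rounds, all nodes accept if the answer is yes, and at least one node rejects if the answer is no. - *Symmetry*: the input is a connected graph $G$ with $2n$ nodes indexed $1,\dots,2n$ whose only edge between $G_A=G[\{1,\dots,n\}]$ and $G_B=G[\{n+1,\dots,2n\}]$ is $\{1,n+1\}$; the answer is yes if and only if $x\mapsto x+n$ is an isomorphism from $G_A$ to $G_B$. - *C4-freeness*: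 the input is a connected graph $G$; the answer is yes if and only if $G$ contains no cycle on $4$ vertices (as a subgraph, not necessarily induced). **Theorem.** For every CONGEST algorithm solving Symmetry in polynomially many rounds there is a constant $c>0$ such that for all sufficiently large $n$ there is an input with $2n$ nodes on which its node-activation is at least $c\,n^2/\log n$, and one on which its edge-activation is at least $c\,n^2/\log n$. For every CONGEST algorithm solving C4-freeness in polynomially many rounds there is a constant $c>0$ such that for all sufficiently large $n$ there is an input with $n$ nodes on which its node-activation is at least $c\,\sqrt n/\log n$, and one on which its edge-activation is at least $c\,\sqrt n/\log n$. Both statements hold even if the algorithm is only required to be a CONGEST algorithm, to terminate in polynomially many rounds and to be correct on networks in which the identifier of every node is its index and $N$ is the exact number of nodes, and the inputs with large activation can then be taken of this kind. -/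

import Mathlib

open Filter Asymptotics

/-- A network on which a distributed algorithm is run: a connected graph on `n` nodes, distinct
positive identifiers, a number `N` that bounds both the number of nodes and the identifiers, and at
each node `v` a port numbering, i.e. an enumeration `ports v` of the neighbours of `v`. -/
structure Network where
  n : ℕ
  graph : SimpleGraph (Fin n)
  connected : graph.Connected
  ident : Fin n → ℕ
  ident_injective : Function.Injective ident
  N : ℕ
  n_le : n ≤ N
  ident_mem : ∀ v, ident v ∈ Set.Icc 1 N
  ports : Fin n → List (Fin n)
  ports_nodup : ∀ v, (ports v).Nodup
  mem_ports : ∀ v u, u ∈ ports v ↔ graph.Adj v u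

/-- The vertex `v : Fin n` has index `v + 1`. In a network identified by index, this is its
identifier, and the number of nodes is known exactly. -/
def Network.IdentifiedByIndex (I : Network) : Prop :=
  (∀ v, I.ident v = v.val + 1) ∧ I.N = I.n

/-- A deterministic synchronous message-passing algorithm with accept/reject outputs. All nodes run
the same algorithm, with unbounded local computation.

A node starts from `N`, its own identifier and the list of the identifiers of its neighbours in the
order of its ports. (Algorithms whose nodes initially know only `N`, their identifier and their
number of ports are those for which `init` uses only the length of that list.) In each round,
`send s p` is the bit string sent through port `p` by a node in state `s`, where `none` means that
no message is sent. Then `receive s l` is the next state, where `l` lists what came in at the ports.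
A node terminates when its state has an output (`true` is accept, `false` is reject). -/
structure Algorithm where
  State : Type
  init : (N ident : ℕ) → (nbrs : List ℕ) → State
  send : State → (port : ℕ) → Option (List Bool)
  receive : State → List (Option (List Bool)) → State
  output : State → Option Bool

namespace Algorithm

/-- What `u` sends to its neighbour `v` in a round that starts with the states `σ`. A terminated
node sends nothing. -/
def outgoing (A : Algorithm) (I : Network) (σ : Fin I.n → A.State) (u v : Fin I.n) :
    Option (List Bool) :=
  if (A.output (σ u)).isSome then none else A.send (σ u) ((I.ports u).idxOf v)

/-- The states of the nodes after `r` rounds. A terminated node keeps its state. -/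
def state (A : Algorithm) (I : Network) : ℕ → Fin I.n → A.State
  | 0 => fun v => A.init I.N (I.ident v) ((I.ports v).map I.ident)
  | r + 1 => fun v =>
      if (A.output (A.state I r v)).isSome then A.state I r v
      else A.receive (A.state I r v)
        ((I.ports v).map fun u => A.outgoing I (A.state I r) u v)

/-- In round `r` (the rounds are numbered from `0`), `u` sends the message `m` to its
neighbour `v`. -/
def Sends (A : Algorithm) (I : Network) (r : ℕ) (u v : Fin I.n) (m : List Bool) : Prop :=
  I.graph.Adj u v ∧ A.outgoing I (A.state I r) u v = some m

/-- The node `v` is active in round `r`: it sends a message to at least one neighbour. -/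
def NodeActive (A : Algorithm) (I : Network) (v : Fin I.n) (r : ℕ) : Prop :=
  ∃ u m, A.Sends I r v u m

/-- The edge `e` is active in round `r`: a message traverses it, in at least one direction. -/
def EdgeActive (A : Algorithm) (I : Network) (e : Sym2 (Fin I.n)) (r : ℕ) : Prop :=
  ∃ u v m, s(u, v) = e ∧ A.Sends I r u v m

/-- The node-activation of `A` on `I`: the maximum over the nodes of the number of rounds in which
the node is active. (These sets of rounds are finite as soon as all nodes terminate.) -/
noncomputable def nact (A : Algorithm) (I : Network) : ℕ :=
  Finset.univ.sup fun v : Fin I.n => {r | A.NodeActive I v r}.ncard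

open Classical in
/-- The edge-activation of `A` on `I`: the maximum over the edges of the number of rounds in which
the edge is active. -/
noncomputable def eact (A : Algorithm) (I : Network) : ℕ :=
  I.graph.edgeFinset.sup fun e => {r | A.EdgeActive I e r}.ncard

end Algorithm

/-- A distributed decision problem: the networks that are admitted as inputs, and those among them
that have to be accepted. -/
structure DecisionProblem where
  Admissible : Network → Prop
  Yes : Network → Prop

/-- On the inputs of `P`, the algorithm sends only messages of `O(log n)` bits. -/
def Algorithm.IsCongest (A : Algorithm) (P : DecisionProblem) : Prop :=
  ∃ b : ℕ → ℕ, (fun n => (b n : ℝ)) =O[atTop] (fun n : ℕ => Real.log n) ∧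
    ∀ I, P.Admissible I → ∀ r u v m, A.Sends I r u v m → m.length ≤ b I.n

/-- On every input of `P`, all nodes have terminated after a polynomial number of rounds; all nodes
accept if the answer is yes, and at least one node rejects if the answer is no. -/
def Algorithm.SolvesInPolyRounds (A : Algorithm) (P : DecisionProblem) : Prop :=
  ∃ R : ℕ → ℕ, (∃ d : ℕ, (fun n => (R n : ℝ)) =O[atTop] (fun n : ℕ => (n : ℝ) ^ d)) ∧
    ∀ I, P.Admissible I →
      (∀ v, (A.output (A.state I (R I.n) v)).isSome) ∧
      (P.Yes I → ∀ v, A.output (A.state I (R I.n) v) = some true) ∧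
      (¬ P.Yes I → ∃ v, A.output (A.state I (R I.n) v) = some false)

/-- The graph has `2 * k` vertices, and its only edge between the first `k` vertices and the last
`k` vertices joins the first vertex of each half. -/
def Network.TwoHalves (I : Network) (k : ℕ) : Prop :=
  I.n = 2 * k ∧ ∀ u v : Fin I.n, u.val < k → k ≤ v.val →
    (I.graph.Adj u v ↔ u.val = 0 ∧ v.val = k)

/-- Symmetry: decide whether the shift `x ↦ x + k` is an isomorphism from the subgraph induced by
the first half of the vertices to the one induced by the second half. -/
def symmetryProblem : DecisionProblem where
  Admissible I := I.IdentifiedByIndex ∧ ∃ k, I.TwoHalves k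
  Yes I := ∃ k, I.TwoHalves k ∧
    ∃ f : I.graph.induce {v | v.val < k} ≃g I.graph.induce {v | k ≤ v.val},
      ∀ x, (f x).val.val = x.val.val + k

/-- C4-freeness: decide whether the graph has no cycle on four vertices (as a subgraph, not
necessarily induced). -/
def c4FreeProblem : DecisionProblem where
  Admissible I := I.IdentifiedByIndex
  Yes I := (SimpleGraph.cycleGraph 4).Free I.graph

/-! This is a fooling-set argument that charges for silence. Cut a network into two sides; the edges
seen from one side encode `x`, those seen from the other encode `y`. If the accepting runs on `G x
x` and `G y y` have the same traffic across the cut, they can be spliced into runs on `G x y` and `G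
y x` in which every node accepts (`state_mixed`). One of these is a no-instance when `x ≠ y`, so the
traffic determines `x`.

Traffic is a set of triples (round, ordered cut pair, message). Recording the round accounts for
information conveyed by silence, and with polynomially many rounds and `O(log n)`-bit messages a
triple costs only `O(log n)` bits. If each ordered pair in `D` is used in at most `k` rounds, at
most `|D| * k` triples occur, so `log |S| ≤ |D| * k * O(log n)` (`FoolingFamily.log_card_le`). Both
activations bound such a `k`.

For Symmetry the cut is a single edge, and a half encodes an arbitrary bipartite graph, hence about
`n ^ 2 / 4` bits. For C4-freeness, two C4-free graphs on the same vertices are joined by a perfect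
matching; a 4-cycle then appears exactly when they share an edge. Point-line incidences over `ZMod
p`, with `p` of order `√n`, give order `p ^ 3` bits across a cut of order `p ^ 2`, so `k` is at
least of order `p / log n`. -/

open Classical in
/-- The network identified by index on a given connected graph, with the ports of each node sorted
by the index of the neighbour. -/
noncomputable def Network.ofGraph {n : ℕ} (G : SimpleGraph (Fin n)) (h : G.Connected) :
    Network where
  n := n
  graph := G
  connected := h
  ident v := v.val + 1
  ident_injective u v huv := by simpa [Fin.ext_iff] using huv
  N := n
  n_le := le_rfl
  ident_mem v := ⟨by simp, v.isLt⟩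
  ports v := (List.finRange n).filter fun u => G.Adj v u
  ports_nodup v := (List.nodup_finRange n).filter _
  mem_ports v u := by simp

theorem Network.ofGraph_identifiedByIndex {n : ℕ} (G : SimpleGraph (Fin n)) (h : G.Connected) :
    (Network.ofGraph G h).IdentifiedByIndex :=
  ⟨fun _ => rfl, rfl⟩

/-- Sorting the ports makes a node's local view a function of its neighbourhood alone, so a node
cannot tell apart two graphs in which it has the same neighbours. -/
theorem Network.ofGraph_ports_congr {n : ℕ} {G G' : SimpleGraph (Fin n)} (h : G.Connected)
    (h' : G'.Connected) {v : Fin n} (hv : ∀ u, G.Adj v u ↔ G'.Adj v u) :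
    (Network.ofGraph G h).ports v = (Network.ofGraph G' h').ports v := by
  exact List.filter_congr fun u _ => decide_eq_decide.2 (hv u)

/-! ### Termination, and activation as a bound on the traffic through an ordered pair -/

namespace Algorithm

section Termination

variable (A : Algorithm) (I : Network)

theorem output_state_isSome_of_le {r s : ℕ} (hrs : r ≤ s) {v : Fin I.n}
    (h : (A.output (A.state I r v)).isSome) : (A.output (A.state I s v)).isSome := by
  induction s, hrs using Nat.le_induction with
  | base => exact h
  | succ s _ ih => simp [state, ih]

variable {A I}

theorem Sends.lt {R r : ℕ} (h : ∀ v, (A.output (A.state I R v)).isSome) {u v : Fin I.n}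
    {m : List Bool} (hs : A.Sends I r u v m) : r < R := by
  by_contra hr
  have := A.output_state_isSome_of_le I (not_lt.1 hr) (h u)
  simp [Sends, outgoing, this] at hs

theorem ncard_sends_le_nact {R : ℕ} (h : ∀ v, (A.output (A.state I R v)).isSome) (u v : Fin I.n) :
    {r | ∃ m, A.Sends I r u v m}.ncard ≤ A.nact I := by
  refine le_trans (Set.ncard_le_ncard ?_ ?_)
    (Finset.le_sup (f := fun v : Fin I.n => {r | A.NodeActive I v r}.ncard) (Finset.mem_univ u))
  · rintro r ⟨m, hm⟩
    exact ⟨v, m, hm⟩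
  -- Termination is essential here: `Set.ncard` of an infinite set is `0`.
  · refine (Set.finite_Iio R).subset ?_
    rintro r ⟨w, m, hm⟩
    exact hm.lt h

theorem ncard_sends_le_eact {R : ℕ} (h : ∀ v, (A.output (A.state I R v)).isSome) (u v : Fin I.n) :
    {r | ∃ m, A.Sends I r u v m}.ncard ≤ A.eact I := by
  classical
  by_cases hadj : I.graph.Adj u v
  · refine le_trans (Set.ncard_le_ncard ?_ ?_)
      (Finset.le_sup (f := fun e => {r | A.EdgeActive I e r}.ncard)
        (b := s(u, v)) (by simpa using hadj))
    · rintro r ⟨m, hm⟩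
      exact ⟨u, v, m, rfl, hm⟩
    · refine (Set.finite_Iio R).subset ?_
      rintro r ⟨a, b, m, -, hm⟩
      exact hm.lt h
  · simp [Sends, hadj]

end Termination

/-! ### Splicing two runs along a cut -/

section Mixing

variable {A : Algorithm} {n : ℕ} {G G₁ G₂ : SimpleGraph (Fin n)} (h : G.Connected)
  (h₁ : G₁.Connected) (h₂ : G₂.Connected)

theorem outgoing_congr {σ σ' : Fin n → A.State} {u v : Fin n} (hσ : σ u = σ' u)
    (hu : ∀ w, G.Adj u w ↔ G₁.Adj u w) :
    A.outgoing (Network.ofGraph G h) σ u v = A.outgoing (Network.ofGraph G₁ h₁) σ' u v := by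
  have := Network.ofGraph_ports_congr h h₁ hu
  unfold outgoing
  rw [this, hσ]
  rfl

/-- A node of `P` receives from inside `P` what it receives on `G₁`, and from outside what is sent
on `G₂`; the latter equals the `G₁` traffic by `hT`. Only this side is proved, since exchanging `P`
with `Pᶜ` and `G₁` with `G₂` gives the other. -/
theorem state_succ_congr {P : Set (Fin n)} (hP : ∀ v ∈ P, ∀ u, G.Adj v u ↔ G₁.Adj v u)
    (hPc : ∀ v ∉ P, ∀ u, G.Adj v u ↔ G₂.Adj v u) {r : ℕ}
    (hT : ∀ u v m, u ∉ P → v ∈ P → (A.Sends (Network.ofGraph G₁ h₁) r u v m ↔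
      A.Sends (Network.ofGraph G₂ h₂) r u v m))
    (ih₁ : ∀ v ∈ P, A.state (Network.ofGraph G h) r v = A.state (Network.ofGraph G₁ h₁) r v)
    (ih₂ : ∀ v ∉ P, A.state (Network.ofGraph G h) r v = A.state (Network.ofGraph G₂ h₂) r v)
    (v : Fin n) (hv : v ∈ P) :
    A.state (Network.ofGraph G h) (r + 1) v = A.state (Network.ofGraph G₁ h₁) (r + 1) v := by
  have hports := Network.ofGraph_ports_congr h h₁ (hP v hv)
  simp only [state]
  rw [ih₁ v hv, hports]
  congr 2
  refine List.map_congr_left fun u hu => ?_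
  have hvu : G₁.Adj v u := ((Network.ofGraph G₁ h₁).mem_ports v u).1 hu
  by_cases huP : u ∈ P
  · exact outgoing_congr h h₁ (ih₁ u huP) (hP u huP)
  · refine (outgoing_congr h h₂ (ih₂ u huP) (hPc u huP)).trans ?_
    -- `Sends` includes adjacency, so equivalence of `Sends` gives equality of the optional messages
    -- only once `u` and `v` are adjacent in both graphs.
    have hvu₂ : G₂.Adj u v := (hPc u huP v).1 ((hP v hv u).2 hvu).symm
    refine Option.ext fun m => ?_
    have := hT u v m huP hv
    simp only [Sends] at this
    exact ⟨fun hm => (this.2 ⟨hvu₂, hm⟩).2, fun hm => (this.1 ⟨hvu.symm, hm⟩).2⟩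

/-- If a graph looks like `G₁` from `P` and like `G₂` from the complement of `P`, and the runs on
`G₁` and `G₂` agree on the messages between `P` and its complement, then the run on the mixed graph
agrees with the one on `G₁` inside `P` and with the one on `G₂` outside. -/
theorem state_mixed {P : Set (Fin n)} (hP : ∀ v ∈ P, ∀ u, G.Adj v u ↔ G₁.Adj v u)
    (hPc : ∀ v ∉ P, ∀ u, G.Adj v u ↔ G₂.Adj v u)
    (hT : ∀ r u v m, (u ∈ P ↔ v ∉ P) → (A.Sends (Network.ofGraph G₁ h₁) r u v m ↔
      A.Sends (Network.ofGraph G₂ h₂) r u v m)) (r : ℕ) :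
    (∀ v ∈ P, A.state (Network.ofGraph G h) r v = A.state (Network.ofGraph G₁ h₁) r v) ∧
    (∀ v ∉ P, A.state (Network.ofGraph G h) r v = A.state (Network.ofGraph G₂ h₂) r v) := by
  induction r with
  | zero =>
    constructor
    · intro v hv
      have := Network.ofGraph_ports_congr h h₁ (hP v hv)
      simp only [state]
      rw [this]
      rfl
    · intro v hv
      have := Network.ofGraph_ports_congr h h₂ (hPc v hv)
      simp only [state]
      rw [this]
      rfl
  | succ r ih =>
    constructor
    · exact state_succ_congr h h₁ h₂ hP hPc (fun u v m hu hv => hT r u v m (by tauto)) ih.1 ih.2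
    · exact state_succ_congr (P := Pᶜ) h h₂ h₁ hPc (fun v hv => hP v (by simpa using hv))
        (fun u v m hu hv => (hT r u v m (by simp at hu hv; tauto)).symm) ih.2
        (fun v hv => ih.1 v (by simpa using hv))

end Mixing

end Algorithm

/-! ### Counting the traffic of a fooling family -/

/-- Lists of length at most `b`, as functions on `Fin b`. -/
theorem List.ext_of_length_le {α : Type*} {b : ℕ} {l l' : List α} (hl : l.length ≤ b)
    (hl' : l'.length ≤ b) (h : ∀ i : Fin b, l[i.val]? = l'[i.val]?) : l = l' := by
  refine List.ext_getElem? fun i => ?_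
  by_cases hi : i < b
  · exact h ⟨i, hi⟩
  · rw [List.getElem?_eq_none (by omega), List.getElem?_eq_none (by omega)]

/-- An injective family of finite sets, each with at most `k` elements, has at most
`(card T + 1) ^ k` members. -/
theorem card_le_pow_of_injective_finset {S T : Type*} [Fintype S] [Fintype T] {k : ℕ}
    (f : S → Finset T) (hf : Function.Injective f) (hk : ∀ s, (f s).card ≤ k) :
    Fintype.card S ≤ (Fintype.card T + 1) ^ k := by
  classical
  have hex : ∀ s, ∃ g : Fin k → Option T, ∀ t, t ∈ f s ↔ ∃ i, g i = some t := by
    intro s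
    refine ⟨fun i => (f s).toList[i.val]?, fun t => ?_⟩
    rw [← Finset.mem_toList, List.mem_iff_getElem?]
    constructor
    · rintro ⟨i, hi⟩
      have : i < (f s).toList.length := (List.getElem?_eq_some_iff.1 hi).1
      rw [Finset.length_toList] at this
      exact ⟨⟨i, this.trans_le (hk s)⟩, hi⟩
    · rintro ⟨i, hi⟩
      exact ⟨i, hi⟩
  choose g hg using hex
  have hinj : Function.Injective g := by
    intro s s' h
    refine hf (Finset.ext fun t => ?_)
    rw [hg, hg, h]
  simpa using Fintype.card_le_of_injective g hinj

/-- A fooling set for the problem `Q` on `n` nodes. In the graph `G x y`, the edges at a node in `P`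
depend only on `x` and those at the other nodes only on `y`; each `G x x` has to be accepted, but
not both `G x y` and `G y x` if `x ≠ y`. All edges leaving or entering `P` are among the ordered
pairs in `D`. -/
structure FoolingFamily (Q : DecisionProblem) (n : ℕ) (S : Type*) where
  G : S → S → SimpleGraph (Fin n)
  connected : ∀ x y, (G x y).Connected
  P : Set (Fin n)
  adj_of_mem : ∀ x y y', ∀ v ∈ P, ∀ u, (G x y).Adj v u ↔ (G x y').Adj v u
  adj_of_notMem : ∀ x x' y, ∀ v ∉ P, ∀ u, (G x y).Adj v u ↔ (G x' y).Adj v u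
  admissible : ∀ x y, Q.Admissible (Network.ofGraph (G x y) (connected x y))
  yes : ∀ x, Q.Yes (Network.ofGraph (G x x) (connected x x))
  no : ∀ x y, x ≠ y → ¬ Q.Yes (Network.ofGraph (G x y) (connected x y)) ∨
    ¬ Q.Yes (Network.ofGraph (G y x) (connected y x))
  D : Finset (Fin n × Fin n)
  mem_D : ∀ x u v, (u ∈ P ↔ v ∉ P) → (G x x).Adj u v → (u, v) ∈ D

namespace FoolingFamily

variable {Q : DecisionProblem} {n : ℕ} {S : Type*} (F : FoolingFamily Q n S)

/-- The network on the graph `G x y` of a fooling family. -/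
noncomputable def net (x y : S) : Network :=
  Network.ofGraph (F.G x y) (F.connected x y)

variable {A : Algorithm} {R b : ℕ → ℕ}

/-- If on each `G x x` every ordered pair of nodes carries messages in at most `k` rounds, then the
fooling family is small. -/
theorem card_le [Fintype S] {k : ℕ}
    (hb : ∀ I, Q.Admissible I → ∀ r u v m, A.Sends I r u v m → m.length ≤ b I.n)
    (hR : ∀ I, Q.Admissible I → (∀ v, (A.output (A.state I (R I.n) v)).isSome) ∧
      (Q.Yes I → ∀ v, A.output (A.state I (R I.n) v) = some true) ∧
      (¬ Q.Yes I → ∃ v, A.output (A.state I (R I.n) v) = some false))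
    (hk : ∀ x u v, {r | ∃ m, A.Sends (F.net x x) r u v m}.ncard ≤ k) :
    Fintype.card S ≤ (R n * F.D.card * 3 ^ b n + 1) ^ (F.D.card * k) := by
  classical
  have hterm := fun x => (hR _ (F.admissible x x)).1
  have hacc := fun x => (hR _ (F.admissible x x)).2.1 (F.yes x)
  -- Encoding a message by its first `b n` entries, with `none` past the end, embeds the admissible
  -- messages in a type of size `3 ^ b n`.
  let tok : List Bool → (Fin (b n) → Option Bool) := fun m i => m[i.val]?
  let f : S → Finset (Fin (R n) × F.D × (Fin (b n) → Option Bool)) := fun x =>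
    Finset.univ.filter fun t => ∃ m,
      A.Sends (F.net x x) t.1 t.2.1.1.1 t.2.1.1.2 m ∧ tok m = t.2.2
  have hsub : ∀ x y, f x = f y → ∀ r (u v : Fin n) m, (u ∈ F.P ↔ v ∉ F.P) →
      A.Sends (F.net x x) r u v m →
      A.Sends (F.net y y) r u v m := by
    intro x y hxy r u v m huv hs
    have hmem : ((⟨r, hs.lt (hterm x)⟩, ⟨(u, v), F.mem_D x u v huv hs.1⟩, tok m) :
        Fin (R n) × F.D × (Fin (b n) → Option Bool)) ∈ f x := by
      simp only [f, Finset.mem_filter, Finset.mem_univ, true_and]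
      exact ⟨m, hs, rfl⟩
    rw [hxy] at hmem
    simp only [f, Finset.mem_filter, Finset.mem_univ, true_and] at hmem
    obtain ⟨m', hs', hm'⟩ := hmem
    have : m' = m := List.ext_of_length_le (hb _ (F.admissible y y) _ _ _ _ hs')
      (hb _ (F.admissible x x) _ _ _ _ hs) (congrFun hm')
    exact this ▸ hs'
  -- Every node of the spliced run ends as in one of two accepting runs, so none can reject.
  have hmix : ∀ x y, f x = f y → Q.Yes (F.net x y) := by
    intro x y hxy
    by_contra hnot
    obtain ⟨v, hv⟩ := (hR _ (F.admissible x y)).2.2 hnot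
    have := Algorithm.state_mixed (F.connected x y) (F.connected x x) (F.connected y y)
      (F.adj_of_mem x y x) (F.adj_of_notMem x y y)
      (fun r u v m huv => ⟨hsub x y hxy r u v m huv, hsub y x hxy.symm r u v m huv⟩) (R n)
    by_cases hvP : v ∈ F.P
    · replace hv := (congrArg A.output (this.1 v hvP)).symm.trans hv
      simpa using (hacc x v).symm.trans hv
    · replace hv := (congrArg A.output (this.2 v hvP)).symm.trans hv
      simpa using (hacc y v).symm.trans hv
  have hinj : Function.Injective f := by
    intro x y hxy
    by_contra hne
    rcases F.no x y hne with h | h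
    · exact h (hmix x y hxy)
    · exact h (hmix y x hxy.symm)
  have hcard : ∀ x, (f x).card ≤ F.D.card * k := by
    intro x
    rw [← Fintype.card_coe F.D, mul_comm]
    -- Group the triples by ordered pair: in one group the round determines the message, so each
    -- group has at most `k` elements.
    refine Finset.card_le_mul_card_image_of_maps_to (f := fun t => t.2.1) (t := Finset.univ)
      (fun _ _ => Finset.mem_univ _) k fun e _ => ?_
    refine le_trans ?_ (hk x e.1.1 e.1.2)
    rw [← Set.ncard_coe_finset]
    refine Set.ncard_le_ncard_of_injOn (fun t => t.1.val) ?_ ?_ ?_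
    · intro t ht
      simp only [f, Finset.coe_filter, Finset.mem_filter, Finset.mem_univ, true_and,
        Set.mem_ofPred_eq] at ht
      obtain ⟨⟨m, hm, -⟩, rfl⟩ := ht
      exact ⟨m, hm⟩
    · intro t ht t' ht' htt
      simp only [f, Finset.coe_filter, Finset.mem_filter, Finset.mem_univ, true_and,
        Set.mem_ofPred_eq] at ht ht'
      obtain ⟨⟨m, hm, hmt⟩, he⟩ := ht
      obtain ⟨⟨m', hm', hmt'⟩, he'⟩ := ht'
      have h1 : t.1 = t'.1 := Fin.ext htt
      have h2 : t.2.1 = t'.2.1 := he.trans he'.symm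
      rw [h1, h2] at hm
      have : m = m' := Option.some_injective _ (hm.2.symm.trans hm'.2)
      refine Prod.ext h1 (Prod.ext h2 ?_)
      rw [← hmt, ← hmt', this]
    · refine (Set.finite_Iio (R n)).subset ?_
      rintro r ⟨m, hm⟩
      exact hm.lt (hterm x)
  have := card_le_pow_of_injective_finset f hinj hcard
  simpa [mul_assoc] using this

/-- The cut size is relaxed to `n` only inside the logarithm, making that factor independent of the
family; outside it must stay exact. -/
theorem log_card_le [Fintype S] [Nonempty S]
    (hb : ∀ I, Q.Admissible I → ∀ r u v m, A.Sends I r u v m → m.length ≤ b I.n)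
    (hR : ∀ I, Q.Admissible I → (∀ v, (A.output (A.state I (R I.n) v)).isSome) ∧
      (Q.Yes I → ∀ v, A.output (A.state I (R I.n) v) = some true) ∧
      (¬ Q.Yes I → ∃ v, A.output (A.state I (R I.n) v) = some false))
    (hD : F.D.card ≤ n) {k : ℕ}
    (hk : ∀ x u v, {r | ∃ m, A.Sends (F.net x x) r u v m}.ncard ≤ k) :
    Real.log (Fintype.card S) ≤
      F.D.card * k * Real.log (R n * n * 3 ^ b n + 1) := by
  have h : Fintype.card S ≤ (R n * n * 3 ^ b n + 1) ^ (F.D.card * k) :=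
    (F.card_le hb hR hk).trans (by gcongr)
  have h' : (Fintype.card S : ℝ) ≤ ((R n * n * 3 ^ b n + 1 : ℝ)) ^ (F.D.card * k) := by
    exact_mod_cast h
  have := Real.log_le_log (by exact_mod_cast Fintype.card_pos) h'
  rw [Real.log_pow] at this
  exact_mod_cast this

theorem exists_log_card_le_nact [Fintype S] [Nonempty S]
    (hb : ∀ I, Q.Admissible I → ∀ r u v m, A.Sends I r u v m → m.length ≤ b I.n)
    (hR : ∀ I, Q.Admissible I → (∀ v, (A.output (A.state I (R I.n) v)).isSome) ∧
      (Q.Yes I → ∀ v, A.output (A.state I (R I.n) v) = some true) ∧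
      (¬ Q.Yes I → ∃ v, A.output (A.state I (R I.n) v) = some false))
    (hD : F.D.card ≤ n) :
    ∃ I, Q.Admissible I ∧ I.n = n ∧ Real.log (Fintype.card S) ≤
      F.D.card * A.nact I * Real.log (R n * n * 3 ^ b n + 1) := by
  -- The most active diagonal network supplies one `k` valid for the whole family.
  obtain ⟨x, hx⟩ := Finite.exists_max fun x => A.nact (F.net x x)
  exact ⟨F.net x x, F.admissible x x, rfl, F.log_card_le hb hR hD fun y u v =>
    (Algorithm.ncard_sends_le_nact (hR _ (F.admissible y y)).1 u v).trans (hx y)⟩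

theorem exists_log_card_le_eact [Fintype S] [Nonempty S]
    (hb : ∀ I, Q.Admissible I → ∀ r u v m, A.Sends I r u v m → m.length ≤ b I.n)
    (hR : ∀ I, Q.Admissible I → (∀ v, (A.output (A.state I (R I.n) v)).isSome) ∧
      (Q.Yes I → ∀ v, A.output (A.state I (R I.n) v) = some true) ∧
      (¬ Q.Yes I → ∃ v, A.output (A.state I (R I.n) v) = some false))
    (hD : F.D.card ≤ n) :
    ∃ I, Q.Admissible I ∧ I.n = n ∧ Real.log (Fintype.card S) ≤
      F.D.card * A.eact I * Real.log (R n * n * 3 ^ b n + 1) := by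
  obtain ⟨x, hx⟩ := Finite.exists_max fun x => A.eact (F.net x x)
  exact ⟨F.net x x, F.admissible x x, rfl, F.log_card_le hb hR hD fun y u v =>
    (Algorithm.ncard_sends_le_eact (hR _ (F.admissible y y)).1 u v).trans (hx y)⟩

end FoolingFamily

/-! ### Asymptotics of the number of triples -/

/-- The number of possible messages in a polynomial number of rounds is polynomial. -/
theorem exists_log_token_count_le {R b : ℕ → ℕ} {d : ℕ}
    (hR : (fun n => (R n : ℝ)) =O[atTop] (fun n : ℕ => (n : ℝ) ^ d))
    (hb : (fun n => (b n : ℝ)) =O[atTop] (fun n : ℕ => Real.log n)) :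
    ∃ C : ℝ, 0 < C ∧ ∀ᶠ n : ℕ in atTop,
      Real.log (R n * n * 3 ^ b n + 1) ≤ C * Real.log n := by
  obtain ⟨c₁, hc₁, h₁⟩ := hR.exists_pos
  obtain ⟨c₂, hc₂, h₂⟩ := hb.exists_pos
  refine ⟨2 + (d + 1) + c₂ * Real.log 3, by positivity, ?_⟩
  filter_upwards [h₁.bound, h₂.bound, eventually_ge_atTop 2,
    tendsto_natCast_atTop_atTop.eventually_ge_atTop c₁] with n h₁ h₂ hn hcn
  have hn' : (2 : ℝ) ≤ n := by exact_mod_cast hn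
  have hlog : 0 ≤ Real.log n := Real.log_nonneg (by linarith)
  simp only [Real.norm_natCast, norm_pow, Real.norm_of_nonneg hlog] at h₁ h₂
  have hle : (R n * n * 3 ^ b n + 1 : ℝ) ≤ n ^ (2 + (d + 1)) * 3 ^ b n := by
    have h3 : (1 : ℝ) ≤ 3 ^ b n := one_le_pow₀ (by norm_num)
    have hp : (1 : ℝ) ≤ n ^ (d + 1) := one_le_pow₀ (by linarith)
    have hRn : (R n * n : ℝ) ≤ n * n ^ (d + 1) := by
      calc (R n * n : ℝ) ≤ (c₁ * n ^ d) * n := by gcongr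
        _ ≤ (n * n ^ d) * n := by gcongr
        _ = n * n ^ (d + 1) := by ring
    have hone : (1 : ℝ) ≤ n ^ (d + 1) * 3 ^ b n := one_le_mul_of_one_le_of_one_le hp h3
    calc (R n * n * 3 ^ b n + 1 : ℝ)
        ≤ (n * n ^ (d + 1)) * 3 ^ b n + n ^ (d + 1) * 3 ^ b n := by gcongr
      _ = (n + 1) * (n ^ (d + 1) * 3 ^ b n) := by ring
      _ ≤ (n ^ 2) * (n ^ (d + 1) * 3 ^ b n) := by gcongr; nlinarith
      _ = n ^ (2 + (d + 1)) * 3 ^ b n := by ring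
  calc Real.log (R n * n * 3 ^ b n + 1) ≤ Real.log (n ^ (2 + (d + 1)) * 3 ^ b n) :=
        Real.log_le_log (by positivity) hle
    _ = (2 + (d + 1)) * Real.log n + b n * Real.log 3 := by
        rw [Real.log_mul (by positivity) (by positivity), Real.log_pow, Real.log_pow]
        push_cast
        ring
    _ ≤ (2 + (d + 1)) * Real.log n + (c₂ * Real.log n) * Real.log 3 := by
        have : 0 ≤ Real.log 3 := Real.log_nonneg (by norm_num)
        gcongr
    _ = _ := by ring

/-! ### Symmetry: two encoded halves joined by one edge -/

section Symmetry

/-- On the indices of one half: `0` is joined to everything, and a set of pairs determines the edges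
between `1, …, a` and `a + 1, …, 2 * a`. -/
def halfRel (a : ℕ) (s : Set (Fin a × Fin a)) (i j : ℕ) : Prop :=
  i = 0 ∨ ∃ p ∈ s, i = p.1.val + 1 ∧ j = p.2.val + 1 + a

/-- Two halves given by `halfRel`, joined by the edge between their first vertices. -/
def symmetryGraph (n a : ℕ) (x y : Set (Fin a × Fin a)) : SimpleGraph (Fin (2 * n)) :=
  SimpleGraph.fromRel fun u v => (u.val < n ∧ v.val < n ∧ halfRel a x u v) ∨
    (n ≤ u.val ∧ n ≤ v.val ∧ halfRel a y (u - n) (v - n)) ∨ (u.val = 0 ∧ v.val = n)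

variable {n a : ℕ} {x y : Set (Fin a × Fin a)} {u v : Fin (2 * n)}

theorem symmetryGraph_adj_left (hu : u.val < n) (hv : v.val < n) :
    (symmetryGraph n a x y).Adj u v ↔
      u.val ≠ v.val ∧ (halfRel a x u v ∨ halfRel a x v u) := by
  simp only [symmetryGraph, SimpleGraph.fromRel_adj, ne_eq, Fin.ext_iff]
  simp [hu, hv, hu.ne, hv.ne, hu.not_ge]

theorem symmetryGraph_adj_right (hu : n ≤ u.val) (hv : n ≤ v.val) :
    (symmetryGraph n a x y).Adj u v ↔
      u.val ≠ v.val ∧ (halfRel a y (u - n) (v - n) ∨ halfRel a y (v - n) (u - n)) := by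
  have hn : 0 < n := by have := u.isLt; omega
  simp only [symmetryGraph, SimpleGraph.fromRel_adj, ne_eq, Fin.ext_iff]
  simp [hu, hv, hu.not_gt, hv.not_gt, (hn.trans_le hu).ne', (hn.trans_le hv).ne']

theorem symmetryGraph_adj_cross (hu : u.val < n) (hv : n ≤ v.val) :
    (symmetryGraph n a x y).Adj u v ↔ u.val = 0 ∧ v.val = n := by
  have hn : 0 < n := by omega
  simp only [symmetryGraph, SimpleGraph.fromRel_adj, ne_eq, Fin.ext_iff]
  simp [hu, hv, hu.not_ge, hv.not_gt, hu.ne, (hu.trans_le hv).ne, (hn.trans_le hv).ne']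

theorem symmetryGraph_connected (hn : 0 < n) : (symmetryGraph n a x y).Connected := by
  have : Nonempty (Fin (2 * n)) := ⟨⟨0, by omega⟩⟩
  refine SimpleGraph.connected_iff_exists_forall_reachable _ |>.2 ⟨⟨0, by omega⟩, fun v => ?_⟩
  by_cases hv : v.val < n
  · by_cases hv0 : v.val = 0
    · rw [show v = ⟨0, by omega⟩ from Fin.ext hv0]
    · exact ((symmetryGraph_adj_left hn hv).2 ⟨fun h => hv0 h.symm, .inl (.inl rfl)⟩).reachable
  · have h0n : (symmetryGraph n a x y).Reachable ⟨0, by omega⟩ ⟨n, by omega⟩ :=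
      ((symmetryGraph_adj_cross hn le_rfl).2 ⟨rfl, rfl⟩).reachable
    refine h0n.trans ?_
    by_cases hvn : v.val = n
    · rw [show v = ⟨n, by omega⟩ from Fin.ext hvn]
    · exact ((symmetryGraph_adj_right le_rfl (not_lt.1 hv)).2
        ⟨fun h => hvn h.symm, .inl (.inl (by simp))⟩).reachable

theorem twoHalves_symmetryGraph (h : (symmetryGraph n a x y).Connected) :
    (Network.ofGraph (symmetryGraph n a x y) h).TwoHalves n :=
  ⟨rfl, fun _ _ hu hv => symmetryGraph_adj_cross hu hv⟩

/-- The shift between the two halves of `Fin (2 * n)`. -/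
def halfShift (n : ℕ) : {v : Fin (2 * n) | v.val < n} ≃ {v : Fin (2 * n) | n ≤ v.val} where
  toFun v := ⟨⟨v.1.val + n, by have : v.1.val < n := v.2; omega⟩, Nat.le_add_left n v.1.val⟩
  invFun v := ⟨⟨v.1.val - n, by omega⟩, by
    have h : n ≤ v.1.val := v.2
    change v.1.val - n < n
    omega⟩
  left_inv v := by simp
  right_inv v := by
    have h : n ≤ v.1.val := v.2
    apply Subtype.ext
    apply Fin.ext
    change v.1.val - n + n = v.1.val
    omega

theorem symmetryProblem_yes_symmetryGraph (h : (symmetryGraph n a x x).Connected) :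
    symmetryProblem.Yes (Network.ofGraph (symmetryGraph n a x x) h) := by
  refine ⟨n, twoHalves_symmetryGraph h, ⟨halfShift n, ?_⟩, fun _ => rfl⟩
  rintro ⟨u, hu⟩ ⟨v, hv⟩
  change (symmetryGraph n a x x).Adj ⟨u.val + n, _⟩ ⟨v.val + n, _⟩ ↔
    (symmetryGraph n a x x).Adj u v
  rw [symmetryGraph_adj_left hu hv,
    symmetryGraph_adj_right (Nat.le_add_left n u.val) (Nat.le_add_left n v.val)]
  simp

/-- The ranges `1, …, a` and `a + 1, …, 2 * a` are disjoint and avoid `0`, so an edge between them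
can come only from its own pair. -/
theorem halfRel_pair_iff (p : Fin a × Fin a) :
    (halfRel a x (p.1.val + 1) (p.2.val + 1 + a) ∨ halfRel a x (p.2.val + 1 + a) (p.1.val + 1)) ↔
      p ∈ x := by
  constructor
  · rintro ((h | ⟨q, hq, h₁, h₂⟩) | (h | ⟨q, hq, h₁, h₂⟩))
    · omega
    · have : p = q := Prod.ext (Fin.ext (by omega)) (Fin.ext (by omega))
      exact this ▸ hq
    · omega
    · omega
  · exact fun h => .inl (.inr ⟨p, h, rfl, rfl⟩)

theorem eq_of_symmetryProblem_yes (hna : 2 * a + 1 ≤ n) (h : (symmetryGraph n a x y).Connected)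
    (hyes : symmetryProblem.Yes (Network.ofGraph (symmetryGraph n a x y) h)) : x = y := by
  obtain ⟨k, ⟨hk, -⟩, f, hf⟩ := hyes
  obtain rfl : n = k := by
    change 2 * n = 2 * k at hk
    omega
  ext p
  have hu : p.1.val + 1 < n := by omega
  have hv : p.2.val + 1 + a < n := by omega
  let u : {v : Fin (2 * n) | v.val < n} := ⟨⟨p.1.val + 1, by omega⟩, hu⟩
  let v : {v : Fin (2 * n) | v.val < n} := ⟨⟨p.2.val + 1 + a, by omega⟩, hv⟩
  have hadj : (symmetryGraph n a x y).Adj (f u).1 (f v).1 ↔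
      (symmetryGraph n a x y).Adj u.1 v.1 := f.map_rel_iff
  have hright : ∀ w w' : Fin (2 * n), w.val = p.1.val + 1 + n → w'.val = p.2.val + 1 + a + n →
      ((symmetryGraph n a x y).Adj w w' ↔ p ∈ y) := by
    intro w w' hw hw'
    rw [symmetryGraph_adj_right (by omega) (by omega), hw, hw', Nat.add_sub_cancel,
      Nat.add_sub_cancel, halfRel_pair_iff, and_iff_right (by omega)]
  rw [← hright _ _ (hf u) (hf v)]
  refine Iff.trans ?_ hadj.symm
  rw [symmetryGraph_adj_left hu hv, halfRel_pair_iff, and_iff_right]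
  change p.1.val + 1 ≠ p.2.val + 1 + a
  omega

/-- Pairs of halves form a fooling set for Symmetry. -/
def symmetryFoolingFamily (n a : ℕ) (hna : 2 * a + 1 ≤ n) :
    FoolingFamily symmetryProblem (2 * n) (Set (Fin a × Fin a)) where
  G := symmetryGraph n a
  connected _ _ := symmetryGraph_connected (by omega)
  P := {v | v.val < n}
  adj_of_mem x y y' v hv u := by
    change v.val < n at hv
    by_cases hu : u.val < n
    · rw [symmetryGraph_adj_left hv hu, symmetryGraph_adj_left hv hu]
    · rw [symmetryGraph_adj_cross hv (not_lt.1 hu), symmetryGraph_adj_cross hv (not_lt.1 hu)]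
  adj_of_notMem x x' y v hv u := by
    replace hv : n ≤ v.val := not_lt.1 hv
    by_cases hu : u.val < n
    · rw [SimpleGraph.adj_comm, symmetryGraph_adj_cross hu hv, SimpleGraph.adj_comm,
        symmetryGraph_adj_cross hu hv]
    · rw [symmetryGraph_adj_right hv (not_lt.1 hu), symmetryGraph_adj_right hv (not_lt.1 hu)]
  admissible x y := ⟨Network.ofGraph_identifiedByIndex _ _, n, twoHalves_symmetryGraph _⟩
  yes x := symmetryProblem_yes_symmetryGraph _
  no x y hxy := .inl fun h => hxy (eq_of_symmetryProblem_yes hna _ h)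
  D := {(⟨0, by omega⟩, ⟨n, by omega⟩), (⟨n, by omega⟩, ⟨0, by omega⟩)}
  mem_D x u v huv hadj := by
    replace huv : u.val < n ↔ ¬ v.val < n := huv
    by_cases hu : u.val < n
    · have := (symmetryGraph_adj_cross hu (not_lt.1 (huv.1 hu))).1 hadj
      simp [Fin.ext_iff, this]
    · have := (symmetryGraph_adj_cross (by tauto) (not_lt.1 hu)).1 hadj.symm
      simp [Fin.ext_iff, this]

theorem log_card_symmetry_index (a : ℕ) :
    Real.log (Fintype.card (Set (Fin a × Fin a))) = a ^ 2 * Real.log 2 := by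
  simp [Fintype.card_set, sq]

/-- The bound on the activation that follows from the fooling set for Symmetry. -/
theorem symmetry_activation_bound {n a d k : ℕ} {C t : ℝ} (hn : 4 ≤ n) (ha : n ≤ 2 * a + 2)
    (hd : d ≤ 2) (hC : 0 < C) (ht : t ≤ C * Real.log ((2 * n : ℕ) : ℝ))
    (h : a ^ 2 * Real.log 2 ≤ d * k * t) :
    Real.log 2 / (64 * C) * ((n : ℝ) ^ 2 / Real.log n) ≤ k := by
  have hn' : (4 : ℝ) ≤ n := by exact_mod_cast hn
  have ha' : (n : ℝ) ≤ 2 * a + 2 := by exact_mod_cast ha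
  have hd' : (d : ℝ) ≤ 2 := by exact_mod_cast hd
  have hlog : 0 < Real.log n := Real.log_pos (by linarith)
  have hlog2 : 0 < Real.log 2 := Real.log_pos (by norm_num)
  have h2n : Real.log ((2 * n : ℕ) : ℝ) ≤ 2 * Real.log n := by
    push_cast
    rw [Real.log_mul (by norm_num) (by linarith)]
    linarith [Real.log_le_log (by norm_num) (show (2 : ℝ) ≤ n by linarith)]
  have hsq : (n : ℝ) ^ 2 ≤ 16 * a ^ 2 := by nlinarith
  -- The factor `64` is `16 * 2 * 2`: from `n ≤ 4 * a`, from the two orientations of the cut edge,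
  -- and from `log (2 * n) ≤ 2 * log n`.
  have hmain : (n : ℝ) ^ 2 * Real.log 2 ≤ k * (64 * C * Real.log n) := by
    calc (n : ℝ) ^ 2 * Real.log 2 ≤ 16 * a ^ 2 * Real.log 2 := by gcongr
      _ ≤ 16 * (d * k * t) := by linarith
      _ ≤ 16 * (d * k * (C * (2 * Real.log n))) := by
        gcongr
        exact ht.trans (by gcongr)
      _ ≤ 16 * (2 * k * (C * (2 * Real.log n))) := by gcongr
      _ = k * (64 * C * Real.log n) := by ring
  rw [div_mul_div_comm, div_le_iff₀ (by positivity)]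
  linarith

theorem symmetry_activation_lower_bound (A : Algorithm) (hA : A.IsCongest symmetryProblem)
    (hA' : A.SolvesInPolyRounds symmetryProblem) :
    ∃ c : ℝ, 0 < c ∧ ∀ᶠ n : ℕ in atTop,
      (∃ I, symmetryProblem.Admissible I ∧ I.n = 2 * n ∧
        c * ((n : ℝ) ^ 2 / Real.log n) ≤ A.nact I) ∧
      (∃ I, symmetryProblem.Admissible I ∧ I.n = 2 * n ∧
        c * ((n : ℝ) ^ 2 / Real.log n) ≤ A.eact I) := by
  obtain ⟨b, hbO, hb⟩ := hA
  obtain ⟨R, ⟨d, hRO⟩, hR⟩ := hA'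
  obtain ⟨C, hC, hbound⟩ := exists_log_token_count_le hRO hbO
  refine ⟨Real.log 2 / (64 * C), div_pos (Real.log_pos (by norm_num)) (by positivity), ?_⟩
  have h2 : Tendsto (fun n : ℕ => 2 * n) atTop atTop :=
    tendsto_id.const_mul_atTop' two_pos
  filter_upwards [h2.eventually hbound, eventually_ge_atTop 4] with n hn hn4
  let F := symmetryFoolingFamily n ((n - 1) / 2) (by omega)
  have hD : F.D.card ≤ 2 := Finset.card_le_two
  have key : ∀ k : ℕ, Real.log (Fintype.card (Set (Fin ((n - 1) / 2) × Fin ((n - 1) / 2)))) ≤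
      F.D.card * k * Real.log (R (2 * n) * (2 * n : ℕ) * 3 ^ b (2 * n) + 1) →
      Real.log 2 / (64 * C) * ((n : ℝ) ^ 2 / Real.log n) ≤ k := by
    intro k hk
    rw [log_card_symmetry_index] at hk
    exact symmetry_activation_bound hn4 (by omega) hD hC hn hk
  obtain ⟨I, hI, hIn, hk⟩ := F.exists_log_card_le_nact hb hR (by omega)
  obtain ⟨J, hJ, hJn, hk'⟩ := F.exists_log_card_le_eact hb hR (by omega)
  exact ⟨⟨I, hI, hIn, key _ hk⟩, ⟨J, hJ, hJn, key _ hk'⟩⟩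

end Symmetry

/-! ### C4-freeness: matched copies of incidence graphs -/

section CFour

theorem cycleGraph_four_free_iff {V : Type*} {G : SimpleGraph V} :
    (SimpleGraph.cycleGraph 4).Free G ↔ ∀ a b c d, a ≠ c → b ≠ d →
      G.Adj a b → G.Adj b c → G.Adj c d → ¬ G.Adj d a := by
  constructor
  · intro h a b c d hac hbd hab hbc hcd hda
    refine h ⟨⟨⟨![a, b, c, d], ?_⟩, ?_⟩⟩
    · intro i j hij
      fin_cases i <;> fin_cases j <;>
        first
        | exact absurd hij (by decide)
        | simp [hab, hbc, hcd, hda, hab.symm, hbc.symm, hcd.symm, hda.symm]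
    · intro i j hij
      have := hab.ne
      have := hbc.ne
      have := hcd.ne
      have := hda.ne
      fin_cases i <;> fin_cases j <;> simp_all
  · rintro h ⟨f⟩
    have hadj : ∀ i j, (SimpleGraph.cycleGraph 4).Adj i j → G.Adj (f i) (f j) :=
      fun i j hij => f.toHom.map_adj hij
    exact h (f 0) (f 1) (f 2) (f 3) (f.injective.ne (by decide)) (f.injective.ne (by decide))
      (hadj _ _ (by decide)) (hadj _ _ (by decide)) (hadj _ _ (by decide)) (hadj _ _ (by decide))

section Doubled

variable {W : Type*} {r : ℕ}

/-- The disjoint union of `HB` and `HA` with the matching between corresponding vertices and `r`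
pendant vertices attached to the vertex `w` of `HA`. -/
def doubledGraph (HA HB : SimpleGraph W) (w : W) (r : ℕ) : SimpleGraph (W ⊕ W ⊕ Fin r) where
  Adj
  | .inl a, .inl b => HB.Adj a b
  | .inl a, .inr (.inl b) => a = b
  | .inr (.inl a), .inl b => a = b
  | .inr (.inl a), .inr (.inl b) => HA.Adj a b
  | .inr (.inl a), .inr (.inr _) => a = w
  | .inr (.inr _), .inr (.inl a) => a = w
  | _, _ => False
  symm := ⟨by
    rintro (a | a | a) (b | b | b) h
    all_goals first | exact h | exact h.symm⟩
  loopless := ⟨by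
    rintro (a | a | a) h
    · exact HB.irrefl h
    · exact HA.irrefl h
    · exact h⟩

/-- Only `HA` needs to be connected: the matching attaches each vertex of `HB` to it. This leaves
`HB` free to be a complement. -/
theorem doubledGraph_connected {HA HB : SimpleGraph W} (hA : HA.Connected) (w : W) :
    (doubledGraph HA HB w r).Connected := by
  let f : HA →g doubledGraph HA HB w r := ⟨fun a => .inr (.inl a), fun h => h⟩
  have : Nonempty (W ⊕ W ⊕ Fin r) := ⟨.inl w⟩
  refine SimpleGraph.connected_iff_exists_forall_reachable _ |>.2 ⟨f w, ?_⟩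
  have hreach : ∀ a, (doubledGraph HA HB w r).Reachable (f w) (f a) :=
    fun a => (hA.preconnected w a).map f
  rintro (a | a | i)
  · refine (hreach a).trans (SimpleGraph.Adj.reachable ?_)
    exact rfl
  · exact hreach a
  · refine SimpleGraph.Adj.reachable ?_
    exact rfl

/-- Pendant vertices lie on no cycle. A 4-cycle meeting both copies cannot use two consecutive
matching edges, which would return to the same vertex; it therefore alternates matching edges with
two copies of one common edge. -/
theorem doubledGraph_free_iff {HA HB : SimpleGraph W} {w : W}
    (hA : (SimpleGraph.cycleGraph 4).Free HA) (hB : (SimpleGraph.cycleGraph 4).Free HB) :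
    (SimpleGraph.cycleGraph 4).Free (doubledGraph HA HB w r) ↔
      ∀ a b, HA.Adj a b → ¬ HB.Adj a b := by
  rw [cycleGraph_four_free_iff] at hA hB ⊢
  constructor
  · intro h a b hab hab'
    exact h (.inr (.inl a)) (.inr (.inl b)) (.inl b) (.inl a) (by simp) (by simp) hab rfl
      hab'.symm rfl
  · intro h
    have hsymmA := fun a b => HA.adj_comm a b
    have hsymmB := fun a b => HB.adj_comm a b
    have hirrA := fun a => HA.irrefl (v := a)
    have hirrB := fun a => HB.irrefl (v := a)
    rintro (a | a | a) (b | b | b) (c | c | c) (d | d | d) hac hbd hab hbc hcd hda <;>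
      simp only [doubledGraph, ne_eq, Sum.inl.injEq, Sum.inr.injEq] at hac hbd hab hbc hcd hda <;>
      grind

end Doubled

/-! ### Point-line incidences over a field -/

section Incidence

variable {K : Type*} [Field K]

/-- The graph of incidences between points `(x, y)` and lines `(m, b)` of equation
`y = m * x + b`, restricted to those whose triple `(x, y, m)` lies in `T`. -/
def incidenceGraph (T : Set (K × K × K)) : SimpleGraph ((K × K) ⊕ (K × K)) where
  Adj
  | .inl p, .inr l => p.2 = l.1 * p.1 + l.2 ∧ (p.1, p.2, l.1) ∈ T
  | .inr l, .inl p => p.2 = l.1 * p.1 + l.2 ∧ (p.1, p.2, l.1) ∈ T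
  | _, _ => False
  symm := ⟨by
    rintro (a | a) (b | b) h
    all_goals exact h⟩
  loopless := ⟨by
    rintro (a | a) h
    all_goals exact h⟩

/-- Two distinct points lie on at most one common line: eliminating the intercepts leaves a product
of the differences of abscissas and of slopes. -/
theorem points_or_lines_eq {p q l k : K × K} (h₁ : p.2 = l.1 * p.1 + l.2)
    (h₂ : q.2 = l.1 * q.1 + l.2) (h₃ : q.2 = k.1 * q.1 + k.2) (h₄ : p.2 = k.1 * p.1 + k.2) :
    p = q ∨ l = k := by
  have h : (p.1 - q.1) * (l.1 - k.1) = 0 := by linear_combination -h₁ + h₂ - h₃ + h₄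
  rcases mul_eq_zero.1 h with h | h
  · left
    have h : p.1 = q.1 := sub_eq_zero.1 h
    exact Prod.ext h (by rw [h₁, h₂, h])
  · right
    have h : l.1 = k.1 := sub_eq_zero.1 h
    refine Prod.ext h ?_
    rw [h] at h₁
    exact add_left_cancel (h₁.symm.trans h₄)

theorem incidenceGraph_free (T : Set (K × K × K)) :
    (SimpleGraph.cycleGraph 4).Free (incidenceGraph T) := by
  rw [cycleGraph_four_free_iff]
  rintro (a | a) (b | b) (c | c) (d | d) hac hbd hab hbc hcd hda <;>
    try first | exact hab | exact hbc | exact hcd | exact hda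
  · rcases points_or_lines_eq hab.1 hbc.1 hcd.1 hda.1 with h | h
    · exact hac (congrArg _ h)
    · exact hbd (congrArg _ h)
  · rcases points_or_lines_eq hbc.1 hcd.1 hda.1 hab.1 with h | h
    · exact hbd (congrArg _ h)
    · exact hac (congrArg _ h).symm

/-- A point and a slope determine the intercept, so triples parametrize all incidences freely; hence
shared edges correspond to shared triples. -/
theorem incidenceGraph_adj {T : Set (K × K × K)} (t : K × K × K) :
    (incidenceGraph T).Adj (.inl (t.1, t.2.1)) (.inr (t.2.2, t.2.1 - t.2.2 * t.1)) ↔ t ∈ T := by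
  simp [incidenceGraph]

theorem incidenceGraph_disjoint_iff {T T' : Set (K × K × K)} :
    (∀ a b, (incidenceGraph T).Adj a b → ¬ (incidenceGraph T').Adj a b) ↔ Disjoint T T' := by
  rw [Set.disjoint_left]
  constructor
  · intro h t ht ht'
    exact h _ _ ((incidenceGraph_adj t).2 ht) ((incidenceGraph_adj t).2 ht')
  · rintro h (a | a) (b | b) hab hab'
    · exact hab
    · exact h hab.2 hab'.2
    · exact h hab.2 hab'.2
    · exact hab

end Incidence

/-! ### The fooling family for C4-freeness -/

section Family

variable (p : ℕ)

/-- The triples with `x = 0`, `x = 1` or `m = 0`; they suffice to connect the incidence graph. -/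
def fixedTriples : Set (ZMod p × ZMod p × ZMod p) :=
  {t | t.1 = 0 ∨ t.1 = 1 ∨ t.2.2 = 0}

/-- The indices of the triples outside `fixedTriples`. -/
abbrev FreeTriple : Type :=
  {x : ZMod p // x ≠ 0 ∧ x ≠ 1} × ZMod p × {m : ZMod p // m ≠ 0}

variable {p}

/-- The triple with a given index. -/
def FreeTriple.triple (t : FreeTriple p) : ZMod p × ZMod p × ZMod p :=
  (t.1.1, t.2.1, t.2.2.1)

theorem FreeTriple.triple_injective : Function.Injective (FreeTriple.triple (p := p)) := by
  rintro ⟨⟨x, hx⟩, y, ⟨m, hm⟩⟩ ⟨⟨x', hx'⟩, y', ⟨m', hm'⟩⟩ h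
  simpa [FreeTriple.triple] using h

theorem FreeTriple.triple_notMem_fixedTriples (t : FreeTriple p) :
    t.triple ∉ fixedTriples p := by
  rintro (h | h | h)
  exacts [t.1.2.1 h, t.1.2.2 h, t.2.2.2 h]

theorem disjoint_triples_iff {s s' : Set (FreeTriple p)} :
    Disjoint (fixedTriples p ∪ Set.image FreeTriple.triple s) (Set.image FreeTriple.triple s'ᶜ) ↔ s ⊆ s' := by
  have hfix : Disjoint (fixedTriples p) (Set.image FreeTriple.triple s'ᶜ) := by
    rw [Set.disjoint_right]
    rintro _ ⟨t, -, rfl⟩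
    exact t.triple_notMem_fixedTriples
  rw [Set.disjoint_union_left, Set.disjoint_image_iff FreeTriple.triple_injective,
    Set.disjoint_compl_right_iff_subset, and_iff_right hfix]

variable [hp : Fact p.Prime]

theorem incidenceGraph_connected {T : Set (ZMod p × ZMod p × ZMod p)} (hT : fixedTriples p ⊆ T) :
    (incidenceGraph T).Connected := by
  let H := incidenceGraph T
  have hadj : ∀ x y m b : ZMod p, y = m * x + b → (x = 0 ∨ x = 1 ∨ m = 0) →
      H.Reachable (.inl (x, y)) (.inr (m, b)) := fun x y m b h h' =>
    SimpleGraph.Adj.reachable (G := H) ⟨h, hT h'⟩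
  -- Climb the line of slope `1` from `(0, y)` to `(1, y + 1)`, then return along the horizontal
  -- line. The axis being connected, horizontal lines reach every other point, and each line `(m,
  -- b)` passes through `(0, b)`.
  have hstep : ∀ y : ZMod p, H.Reachable (.inl (0, y)) (.inl (0, y + 1)) := by
    intro y
    have h₁ := hadj 0 y 1 y (by ring) (by simp)
    have h₂ := hadj 1 (y + 1) 1 y (by ring) (by simp)
    have h₃ := hadj 1 (y + 1) 0 (y + 1) (by ring) (by simp)
    have h₄ := hadj 0 (y + 1) 0 (y + 1) (by ring) (by simp)
    exact ((h₁.trans h₂.symm).trans h₃).trans h₄.symm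
  have haxis : ∀ y : ZMod p, H.Reachable (.inl (0, 0)) (.inl (0, y)) := by
    intro y
    have : ∀ k : ℕ, H.Reachable (.inl (0, 0)) (.inl (0, (k : ZMod p))) := by
      intro k
      induction k with
      | zero => simp
      | succ k ih =>
        push_cast
        exact ih.trans (hstep _)
    simpa using this y.val
  refine SimpleGraph.connected_iff_exists_forall_reachable _ |>.2 ⟨.inl (0, 0), ?_⟩
  rintro (⟨x, y⟩ | ⟨m, b⟩)
  · exact ((haxis y).trans (hadj 0 y 0 y (by ring) (by simp))).trans
      (hadj x y 0 y (by ring) (by simp)).symm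
  · exact (haxis b).trans (hadj 0 b m b (by ring) (by simp))

theorem card_freeTriple : Fintype.card (FreeTriple p) = (p - 2) * (p * (p - 1)) := by
  have h₁ : Fintype.card {x : ZMod p // x ≠ 0 ∧ x ≠ 1} = p - 2 := by
    have : (Finset.univ.filter fun x : ZMod p => x ≠ 0 ∧ x ≠ 1) = ({0, 1} : Finset (ZMod p))ᶜ := by
      ext x
      simp
    rw [Fintype.card_subtype, this, Finset.card_compl, Finset.card_pair zero_ne_one, ZMod.card]
  have h₂ : Fintype.card {m : ZMod p // m ≠ 0} = p - 1 := by
    simp [Fintype.card_subtype_compl]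
  rw [Fintype.card_prod, Fintype.card_prod, h₁, h₂, ZMod.card]

/-- The graph for the sets `s` and `s'`: one copy of the incidence graph has the fixed triples and
those in `s`, the other copy those not in `s'`. -/
def cFourGraph (r : ℕ) (s s' : Set (FreeTriple p)) :
    SimpleGraph (((ZMod p × ZMod p) ⊕ (ZMod p × ZMod p)) ⊕
      ((ZMod p × ZMod p) ⊕ (ZMod p × ZMod p)) ⊕ Fin r) :=
  doubledGraph (incidenceGraph (fixedTriples p ∪ Set.image FreeTriple.triple s))
    (incidenceGraph (Set.image FreeTriple.triple s'ᶜ)) (.inl (0, 0)) r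

theorem cFourGraph_connected (r : ℕ) (s s' : Set (FreeTriple p)) :
    (cFourGraph r s s').Connected :=
  doubledGraph_connected (incidenceGraph_connected Set.subset_union_left) _

theorem cFourGraph_free_iff {r : ℕ} {s s' : Set (FreeTriple p)} :
    (SimpleGraph.cycleGraph 4).Free (cFourGraph r s s') ↔ s ⊆ s' :=
  (doubledGraph_free_iff (incidenceGraph_free _) (incidenceGraph_free _)).trans
    (incidenceGraph_disjoint_iff.trans disjoint_triples_iff)

theorem cFourProblem_yes_iff {n r : ℕ} {s s' : Set (FreeTriple p)}
    (e : Fin n ≃ ((ZMod p × ZMod p) ⊕ (ZMod p × ZMod p)) ⊕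
      ((ZMod p × ZMod p) ⊕ (ZMod p × ZMod p)) ⊕ Fin r)
    (h : ((cFourGraph r s s').comap e).Connected) :
    c4FreeProblem.Yes (Network.ofGraph ((cFourGraph r s s').comap e) h) ↔ s ⊆ s' :=
  (SimpleGraph.free_congr_right (SimpleGraph.Iso.comap e (cFourGraph r s s'))).trans
    cFourGraph_free_iff

/-- Complementary sets of triples form a fooling set for C4-freeness. -/
noncomputable def cFourFoolingFamily {n r : ℕ}
    (e : Fin n ≃ ((ZMod p × ZMod p) ⊕ (ZMod p × ZMod p)) ⊕
      ((ZMod p × ZMod p) ⊕ (ZMod p × ZMod p)) ⊕ Fin r) :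
    FoolingFamily c4FreeProblem n (Set (FreeTriple p)) where
  G s s' := (cFourGraph r s s').comap e
  connected s s' :=
    (SimpleGraph.Iso.comap e (cFourGraph r s s')).connected_iff.2 (cFourGraph_connected r s s')
  P := {v | (e v).isRight}
  adj_of_mem s t t' v hv u := by
    change (e v).isRight at hv
    change (cFourGraph r s t).Adj (e v) (e u) ↔ (cFourGraph r s t').Adj (e v) (e u)
    generalize e v = v at hv ⊢
    rcases v with a | a | a
    · simp at hv
    all_goals rcases e u with b | b | b <;> rfl
  adj_of_notMem s s' t v hv u := by
    change ¬ (e v).isRight at hv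
    change (cFourGraph r s t).Adj (e v) (e u) ↔ (cFourGraph r s' t).Adj (e v) (e u)
    generalize e v = v at hv ⊢
    rcases v with a | a | a
    · rcases e u with b | b | b <;> rfl
    all_goals simp at hv
  admissible s s' := Network.ofGraph_identifiedByIndex _ _
  yes s := (cFourProblem_yes_iff e _).2 subset_rfl
  -- Acceptance means inclusion, so `G s s'` alone may be a yes-instance; distinct sets fail at
  -- least one of the two inclusions.
  no s s' hne := by
    rw [cFourProblem_yes_iff, cFourProblem_yes_iff]
    by_contra! h
    exact hne (h.1.antisymm h.2)
  D := (Finset.univ.image fun w => (e.symm (.inl w), e.symm (.inr (.inl w)))) ∪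
    Finset.univ.image fun w => (e.symm (.inr (.inl w)), e.symm (.inl w))
  mem_D s u v huv hadj := by
    obtain ⟨u, rfl⟩ := e.symm.surjective u
    obtain ⟨v, rfl⟩ := e.symm.surjective v
    replace huv : (e (e.symm u)).isRight ↔ ¬ (e (e.symm v)).isRight := huv
    replace hadj : (cFourGraph r s s).Adj (e (e.symm u)) (e (e.symm v)) := hadj
    rw [e.apply_symm_apply, e.apply_symm_apply] at huv hadj
    rcases u with a | a | a <;> rcases v with b | b | b <;> simp at huv
    · obtain rfl : a = b := hadj
      simp
    · exact hadj.elim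
    · obtain rfl : a = b := hadj
      simp
    · exact hadj.elim

theorem card_cFourFoolingFamily_D {n r : ℕ}
    (e : Fin n ≃ ((ZMod p × ZMod p) ⊕ (ZMod p × ZMod p)) ⊕
      ((ZMod p × ZMod p) ⊕ (ZMod p × ZMod p)) ⊕ Fin r) :
    (cFourFoolingFamily e).D.card ≤ 4 * p ^ 2 := by
  refine (Finset.card_union_le _ _).trans ?_
  refine (add_le_add Finset.card_image_le Finset.card_image_le).trans ?_
  simp [ZMod.card]
  nlinarith

theorem log_card_cFour_index :
    Real.log (Fintype.card (Set (FreeTriple p))) =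
      ((p - 2) * (p * (p - 1)) : ℝ) * Real.log 2 := by
  have h2 := hp.out.two_le
  rw [Fintype.card_set, card_freeTriple]
  push_cast [Nat.cast_sub h2, Nat.cast_sub (one_le_two.trans h2)]
  rw [Real.log_pow]
  push_cast [Nat.cast_sub h2, Nat.cast_sub (one_le_two.trans h2)]
  ring

end Family

/-- A prime `p` of order `√n` with `4 * p ^ 2 ≤ n`. -/
theorem exists_prime_four_mul_sq_le {n : ℕ} (hn : 256 ≤ n) :
    ∃ p : ℕ, p.Prime ∧ 4 ≤ p ∧ 4 * p ^ 2 ≤ n ∧ Real.sqrt n ≤ 4 * p := by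
  have hs : 16 ≤ Nat.sqrt n := Nat.le_sqrt.2 (by omega)
  -- Bertrand's postulate at `⌊√n⌋ / 4`: the upper bound gives `2 * p ≤ ⌊√n⌋`, the strict lower one
  -- `⌊√n⌋ + 1 ≤ 4 * p`.
  obtain ⟨p, hp, hlt, hle⟩ := Nat.exists_prime_lt_and_le_two_mul (Nat.sqrt n / 4) (by omega)
  have h1 : 2 * p ≤ Nat.sqrt n := by omega
  refine ⟨p, hp, by omega, ?_, ?_⟩
  · calc 4 * p ^ 2 = (2 * p) * (2 * p) := by ring
      _ ≤ Nat.sqrt n * Nat.sqrt n := Nat.mul_le_mul h1 h1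
      _ ≤ n := Nat.sqrt_le n
  · have h2 : Nat.sqrt n + 1 ≤ 4 * p := by omega
    refine Real.sqrt_le_iff.2 ⟨by positivity, ?_⟩
    have h3 : n ≤ (4 * p) ^ 2 := by
      rw [sq]
      exact (Nat.lt_succ_sqrt n).le.trans (Nat.mul_le_mul h2 h2)
    exact_mod_cast h3

/-- The bound on the activation that follows from the fooling set for C4-freeness. -/
theorem cFour_activation_bound {n p d k : ℕ} {C t : ℝ} (hn : 2 ≤ n) (hp : 4 ≤ p)
    (hnp : Real.sqrt n ≤ 4 * p) (hd : d ≤ 4 * p ^ 2) (hC : 0 < C) (ht : t ≤ C * Real.log n)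
    (h : ((p - 2) * (p * (p - 1)) : ℝ) * Real.log 2 ≤ d * k * t) :
    Real.log 2 / (64 * C) * (Real.sqrt n / Real.log n) ≤ k := by
  have hn' : (2 : ℝ) ≤ n := by exact_mod_cast hn
  have hp' : (4 : ℝ) ≤ p := by exact_mod_cast hp
  have hd' : (d : ℝ) ≤ 4 * p ^ 2 := by exact_mod_cast hd
  have hlog : 0 < Real.log n := Real.log_pos (by linarith)
  have hlog2 : 0 < Real.log 2 := Real.log_pos (by norm_num)
  have hcube : (p : ℝ) ^ 2 * p ≤ 4 * ((p - 2) * (p * (p - 1))) := by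
    have : (p : ℝ) ^ 2 ≤ 4 * ((p - 2) * (p - 1)) := by nlinarith
    nlinarith
  -- The cut size cancels `p ^ 2` of the cubic count; `16` combines the loss `4` in `hcube` with `d
  -- ≤ 4 * p ^ 2`, and `√n ≤ 4 * p` later makes it `64`.
  have hmul : (p : ℝ) ^ 2 * (p * Real.log 2) ≤ p ^ 2 * (k * (16 * C * Real.log n)) := by
    calc (p : ℝ) ^ 2 * (p * Real.log 2) = p ^ 2 * p * Real.log 2 := by ring
      _ ≤ 4 * ((p - 2) * (p * (p - 1))) * Real.log 2 := by gcongr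
      _ ≤ 4 * (d * k * t) := by linarith
      _ ≤ 4 * (d * k * (C * Real.log n)) := by gcongr
      _ ≤ 4 * (4 * p ^ 2 * k * (C * Real.log n)) := by gcongr
      _ = p ^ 2 * (k * (16 * C * Real.log n)) := by ring
  have hmain : p * Real.log 2 ≤ k * (16 * C * Real.log n) :=
    le_of_mul_le_mul_left hmul (by positivity)
  rw [div_mul_div_comm, div_le_iff₀ (by positivity)]
  nlinarith

theorem cFour_activation_lower_bound (A : Algorithm) (hA : A.IsCongest c4FreeProblem)
    (hA' : A.SolvesInPolyRounds c4FreeProblem) :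
    ∃ c : ℝ, 0 < c ∧ ∀ᶠ n : ℕ in atTop,
      (∃ I, c4FreeProblem.Admissible I ∧ I.n = n ∧
        c * (Real.sqrt n / Real.log n) ≤ A.nact I) ∧
      (∃ I, c4FreeProblem.Admissible I ∧ I.n = n ∧
        c * (Real.sqrt n / Real.log n) ≤ A.eact I) := by
  obtain ⟨b, hbO, hb⟩ := hA
  obtain ⟨R, ⟨d, hRO⟩, hR⟩ := hA'
  obtain ⟨C, hC, hbound⟩ := exists_log_token_count_le hRO hbO
  refine ⟨Real.log 2 / (64 * C), div_pos (Real.log_pos (by norm_num)) (by positivity), ?_⟩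
  filter_upwards [hbound, eventually_ge_atTop 256] with n hn hn256
  obtain ⟨p, hprime, hp4, hpn, hnp⟩ := exists_prime_four_mul_sq_le hn256
  have : Fact p.Prime := ⟨hprime⟩
  -- The four blocks of `p ^ 2` vertices are padded by `n - 4 * p ^ 2` pendant vertices, so every
  -- large `n` is attained exactly.
  have hcard : Fintype.card (((ZMod p × ZMod p) ⊕ (ZMod p × ZMod p)) ⊕
      ((ZMod p × ZMod p) ⊕ (ZMod p × ZMod p)) ⊕ Fin (n - 4 * p ^ 2)) = n := by
    simp only [Fintype.card_sum, Fintype.card_prod, ZMod.card, Fintype.card_fin]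
    rw [sq] at hpn ⊢
    omega
  let F := cFourFoolingFamily (Fintype.equivFinOfCardEq hcard).symm
  have hD : F.D.card ≤ 4 * p ^ 2 := card_cFourFoolingFamily_D _
  have key : ∀ k : ℕ, Real.log (Fintype.card (Set (FreeTriple p))) ≤
      F.D.card * k * Real.log (R n * n * 3 ^ b n + 1) →
      Real.log 2 / (64 * C) * (Real.sqrt n / Real.log n) ≤ k := by
    intro k hk
    rw [log_card_cFour_index] at hk
    exact cFour_activation_bound (by omega) hp4 hnp hD hC hn hk
  obtain ⟨I, hI, hIn, hk⟩ := F.exists_log_card_le_nact hb hR (hD.trans hpn)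
  obtain ⟨J, hJ, hJn, hk'⟩ := F.exists_log_card_le_eact hb hR (hD.trans hpn)
  exact ⟨⟨I, hI, hIn, key _ hk⟩, ⟨J, hJ, hJn, key _ hk'⟩⟩

end CFour

theorem mainTheorem4 (A : Algorithm) :
    (A.IsCongest symmetryProblem → A.SolvesInPolyRounds symmetryProblem →
      ∃ c : ℝ, 0 < c ∧ ∀ᶠ n : ℕ in atTop,
        (∃ I, symmetryProblem.Admissible I ∧ I.n = 2 * n ∧
          c * ((n : ℝ) ^ 2 / Real.log n) ≤ A.nact I) ∧
        (∃ I, symmetryProblem.Admissible I ∧ I.n = 2 * n ∧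
          c * ((n : ℝ) ^ 2 / Real.log n) ≤ A.eact I)) ∧
    (A.IsCongest c4FreeProblem → A.SolvesInPolyRounds c4FreeProblem →
      ∃ c : ℝ, 0 < c ∧ ∀ᶠ n : ℕ in atTop,
        (∃ I, c4FreeProblem.Admissible I ∧ I.n = n ∧
          c * (Real.sqrt n / Real.log n) ≤ A.nact I) ∧
        (∃ I, c4FreeProblem.Admissible I ∧ I.n = n ∧
          c * (Real.sqrt n / Real.log n) ≤ A.eact I)) := by
  exact ⟨symmetry_activation_lower_bound A, cFour_activation_lower_bound A⟩
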